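/- Let $D$ be a weakly connected digraph (possibly infinite, parallel edges allowed, no loops). A cut of $D$ is the set of all edges between the two parts $X_1,X_2$ (its sides) of a bipartition of $V(D)$; it is a dicut if all its edges have their head in a common side. A dibond is an inclusion-minimal non-empty dicut. Two cuts with sides $X_1,X_2$ and $Y_1,Y_2$, respectively, are nested if $X_1\subseteq Y_1$, $Y_1\subseteq X_1$, $X_1\subseteq Y_2$ or $Y_2\subseteq X_1$. A finitary dijoin of $D$ is a set of edges that meets every non-empty finite dicut of $D$. Suppose that at least one of the following holds: (i) $D$ has a finitary dijoin of finite size; (ii) the maximum number of pairwise disjoint non-empty finite dicuts of $D$ is finite; (iii) the maximum number of pairwise disjoint and pairwise nested non-empty finite dicuts of $D$ is finite; (iv) every edge of $D$ lies in only finitely many finite dibonds of $D$; (v) $D$ has no infinite dibond; (vi) $D$ is rayless, that is, its underlying undirected multigraph contains no one-way infinite path. Then $D$ has a nested optimal pair, that is, a pair $(F,\mathcal B)$ such that $F\subseteq E(D)$ is a finitary dijoin of $D$, $\mathcal B$ is a set of pairwise disjoint, pairwise nested finite dibonds of $D$, $F\subseteq\bigcup\mathcal B$, and $|F\cap B|=1$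 for every $B\in\mathcal B$. -/

import Mathlib

universe u v

/-- A directed multigraph with vertex set `V` and edge set `E`: every edge has a tail and a head.
Parallel edges are possible; the absence of loops is the separate predicate
`MultiDigraph.Loopless`. -/
structure MultiDigraph (V : Type u) (E : Type v) where
  /-- The tail (initial vertex) of an edge. -/
  tail : E → V
  /-- The head (terminal vertex) of an edge. -/
  head : E → V

namespace MultiDigraph

variable {V : Type u} {E : Type v} (D : MultiDigraph V E)

/-- No edge is a loop. -/
def Loopless : Prop := ∀ e, D.tail e ≠ D.head e

/-- In the underlying undirected multigraph, the edge `e` joins `x` and `y`. -/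
def Joins (e : E) (x y : V) : Prop :=
  (D.tail e = x ∧ D.head e = y) ∨ (D.tail e = y ∧ D.head e = x)

/-- The underlying undirected multigraph is connected. -/
def WeaklyConnected : Prop :=
  Nonempty V ∧ ∀ x y, Relation.ReflTransGen (fun a b => ∃ e, D.Joins e a b) x y

/-- The cut with sides `X` and `Xᶜ`: all edges with one end in `X` and the other in `Xᶜ`. -/
def cut (X : Set V) : Set E :=
  {e | (D.tail e ∈ X ∧ D.head e ∈ Xᶜ) ∨ (D.tail e ∈ Xᶜ ∧ D.head e ∈ X)}

/-- A dicut is a cut all of whose edges have their head in a common side, here called `X`.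
As in the case of cuts, the empty set is allowed. -/
def IsDicut (B : Set E) : Prop :=
  ∃ X : Set V, B = D.cut X ∧ ∀ e ∈ B, D.head e ∈ X

/-- A dibond is an inclusion-minimal non-empty dicut. -/
def IsDibond (B : Set E) : Prop :=
  Minimal (fun C => D.IsDicut C ∧ C.Nonempty) B

/-- Two cuts with sides `X₁, X₁ᶜ` and `X₂, X₂ᶜ` are nested if a side of one is comparable with a
side of the other. In a weakly connected digraph a cut determines its sides up to swapping them,
so it is irrelevant which sides are chosen here. -/
def Nested (B₁ B₂ : Set E) : Prop :=
  ∃ X₁ X₂ : Set V, B₁ = D.cut X₁ ∧ B₂ = D.cut X₂ ∧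
    (X₁ ⊆ X₂ ∨ X₂ ⊆ X₁ ∨ X₁ ⊆ X₂ᶜ ∨ X₂ᶜ ⊆ X₁)

/-- A finitary dijoin is a set of edges that meets every non-empty finite dicut. -/
def IsFinitaryDijoin (F : Set E) : Prop :=
  ∀ B : Set E, D.IsDicut B → B.Finite → B.Nonempty → (F ∩ B).Nonempty

/-- `(F, 𝓑)` is a nested optimal pair. -/
structure IsNestedOptimalPair (F : Set E) (𝓑 : Set (Set E)) : Prop where
  dijoin : D.IsFinitaryDijoin F
  dibond : ∀ B ∈ 𝓑, D.IsDibond B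
  finite : ∀ B ∈ 𝓑, B.Finite
  disjoint : 𝓑.Pairwise Disjoint
  nested : 𝓑.Pairwise D.Nested
  subset : F ⊆ ⋃₀ 𝓑
  card_inter : ∀ B ∈ 𝓑, (F ∩ B).encard = 1

/-- `𝓒` is a set of pairwise disjoint non-empty finite dicuts. -/
structure IsDisjointDicutFamily (𝓒 : Set (Set E)) : Prop where
  dicut : ∀ B ∈ 𝓒, D.IsDicut B
  finite : ∀ B ∈ 𝓒, B.Finite
  nonempty : ∀ B ∈ 𝓒, B.Nonempty
  disjoint : 𝓒.Pairwise Disjoint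

/-- The underlying undirected multigraph contains no ray: there are no distinct vertices
`r 0, r 1, r 2, …` with an edge joining `r n` and `r (n + 1)` for every `n`. -/
def Rayless : Prop :=
  ¬ ∃ r : ℕ → V, Function.Injective r ∧ ∀ n, ∃ e, D.Joins e (r n) (r (n + 1))

end MultiDigraph

namespace MultiDigraph

variable {V : Type u} {E : Type v} {D : MultiDigraph V E}

/-! ### Cuts and shores of dicuts -/

/-! For a finite edge set `S`, the Lucchesi–Younger theorem for the dicuts inside `S`
(`lucchesi_younger`, by Lovász's argument) equates the largest number of disjoint dicuts with the
least number of edges meeting them all. Uncrossing and shrinking an optimal packing turns it into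
nested dibonds, giving a pair `F S`, `𝓑 S` of equal size (`exists_isNestedOptimalPairOn`).

The infinite case follows by compactness along an ultrafilter on the finite sets `S` in which every
finite set is eventually included. The limit of the `F S` meets each finite dicut, because an
ultrafilter picks one of its finitely many edges. What may fail is that the limit is covered: the
dibonds covering an edge may change forever. There are two remedies. If each edge lies in finitely
many finite dibonds, the ultrafilter picks one of these as well. If packings are bounded, a largest
`𝓑 S₀` remains optimal for every `S ⊇ S₀` and serves as it is.

Conditions (i) and (ii) imply the bound (iii). Conditions (v) and (vi) imply (iv): infinitely many
finite dibonds through one edge have a limit shore whose cut contains no non-empty finite dicut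
(`exists_limit_shore`). This yields an infinite dibond and, by following ends of its edges through
connected sides, a ray. -/

theorem mem_cut_iff {X : Set V} {e : E} : e ∈ D.cut X ↔ (D.tail e ∈ X ↔ D.head e ∉ X) := by
  simp only [cut, Set.mem_ofPred_eq, Set.mem_compl_iff]
  tauto

theorem cut_compl (X : Set V) : D.cut Xᶜ = D.cut X := by
  ext e
  simp only [mem_cut_iff, Set.mem_compl_iff]
  tauto

theorem WeaklyConnected.cut_nonempty (hD : D.WeaklyConnected) {X : Set V} (hX : X.Nonempty)
    (hX' : Xᶜ.Nonempty) : (D.cut X).Nonempty := by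
  by_contra hne
  obtain ⟨a, ha⟩ := hX
  obtain ⟨b, hb⟩ := hX'
  refine hb ?_
  clear hb
  induction hD.2 a b with
  | refl => exact ha
  | tail _ h ih =>
    obtain ⟨e, he⟩ := h
    by_contra hc
    refine hne ⟨e, mem_cut_iff.2 ?_⟩
    have := ih
    rcases he with ⟨rfl, rfl⟩ | ⟨rfl, rfl⟩ <;> simp_all

/-- A set of vertices, neither empty nor everything, which no edge leaves. -/
structure IsShore (D : MultiDigraph V E) (X : Set V) : Prop where
  nonempty : X.Nonempty
  compl_nonempty : Xᶜ.Nonempty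
  head_mem : ∀ e, D.tail e ∈ X → D.head e ∈ X

theorem IsShore.mem_cut {X : Set V} (hX : D.IsShore X) {e : E} :
    e ∈ D.cut X ↔ D.head e ∈ X ∧ D.tail e ∉ X := by
  have := hX.head_mem e
  rw [mem_cut_iff]
  tauto

theorem IsShore.isDicut {X : Set V} (hX : D.IsShore X) : D.IsDicut (D.cut X) :=
  ⟨X, rfl, fun _ he => (hX.mem_cut.1 he).1⟩

theorem IsDicut.exists_isShore {B : Set E} (hB : D.IsDicut B) (hne : B.Nonempty) :
    ∃ X, D.IsShore X ∧ B = D.cut X := by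
  obtain ⟨X, rfl, hX⟩ := hB
  obtain ⟨e, he⟩ := hne
  refine ⟨X, ⟨⟨_, hX e he⟩, ⟨D.tail e, fun h => (mem_cut_iff.1 he).1 h (hX e he)⟩, ?_⟩, rfl⟩
  intro f hf
  by_contra hc
  exact hc (hX f (mem_cut_iff.2 ⟨fun _ => hc, fun _ => hf⟩))

/-- Two sets of vertices cross if all four of their corners are non-empty. -/
def Crossing (X Y : Set V) : Prop :=
  (X \ Y).Nonempty ∧ (Y \ X).Nonempty ∧ (X ∩ Y).Nonempty ∧ (X ∪ Y)ᶜ.Nonempty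

theorem IsShore.inter {X Y : Set V} (hX : D.IsShore X) (hY : D.IsShore Y)
    (h : (X ∩ Y).Nonempty) : D.IsShore (X ∩ Y) where
  nonempty := h
  compl_nonempty := hX.compl_nonempty.mono (Set.compl_subset_compl.2 Set.inter_subset_left)
  head_mem e he := ⟨hX.head_mem e he.1, hY.head_mem e he.2⟩

theorem IsShore.union {X Y : Set V} (hX : D.IsShore X) (hY : D.IsShore Y)
    (h : (X ∪ Y)ᶜ.Nonempty) : D.IsShore (X ∪ Y) where
  nonempty := hX.nonempty.mono Set.subset_union_left
  compl_nonempty := h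
  head_mem e he := he.imp (hX.head_mem e) (hY.head_mem e)

/-! ### Multisets of shores -/

open Classical in
/-- The number of members of `M` whose cut contains `e`. -/
noncomputable def cover (D : MultiDigraph V E) (M : Multiset (Set V)) (e : E) : ℕ :=
  M.countP (fun X => e ∈ D.cut X)

open Classical in
theorem cover_cons (X : Set V) (M : Multiset (Set V)) (e : E) :
    D.cover (X ::ₘ M) e = D.cover M e + if e ∈ D.cut X then 1 else 0 := by
  simp [cover, Multiset.countP_cons]

theorem cover_add (M N : Multiset (Set V)) (e : E) :
    D.cover (M + N) e = D.cover M e + D.cover N e := by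
  simp [cover]

theorem cover_pos {M : Multiset (Set V)} {e : E} :
    0 < D.cover M e ↔ ∃ X ∈ M, e ∈ D.cut X := by
  simp [cover, Multiset.countP_pos]

/-- No edge joins `X \ Y` and `Y \ X`, since a shore containing the tail contains the head. Hence
uncrossing loses nothing. -/
theorem cover_uncross {X Y : Set V} (hX : D.IsShore X) (hY : D.IsShore Y) (h : Crossing X Y)
    (M : Multiset (Set V)) (e : E) :
    D.cover ((X ∩ Y) ::ₘ (X ∪ Y) ::ₘ M) e = D.cover (X ::ₘ Y ::ₘ M) e := by
  classical
  simp only [cover_cons, hX.mem_cut, hY.mem_cut, (hX.inter hY h.2.2.1).mem_cut,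
    (hX.union hY h.2.2.2).mem_cut, Set.mem_inter_iff, Set.mem_union]
  have h1 := hX.head_mem e
  have h2 := hY.head_mem e
  by_cases a : D.head e ∈ X <;> by_cases b : D.head e ∈ Y <;> by_cases c : D.tail e ∈ X <;>
    by_cases d : D.tail e ∈ Y <;> simp_all

theorem exists_crossFree (hD : D.WeaklyConnected) {N : Set E} (hN : N.Finite)
    (M : Multiset (Set V)) (hM : ∀ X ∈ M, D.IsShore X) (hMN : ∀ X ∈ M, D.cut X ⊆ N) :
    ∃ M' : Multiset (Set V), M'.card = M.card ∧ (∀ X ∈ M', D.IsShore X) ∧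
      (∀ e, D.cover M' e = D.cover M e) ∧ ∀ X ∈ M', ∀ Y ∈ M', ¬ Crossing X Y := by
  -- Shores may be infinite, so they are measured on the finite set `R` of ends of edges of `N`. The
  -- sum of `|X ∩ R| ^ 2` is bounded and grows at each uncrossing.
  set R : Set V := D.tail '' N ∪ D.head '' N with hR
  have hRfin : R.Finite := (hN.image _).union (hN.image _)
  have hbound : ∀ M : Multiset (Set V),
      (M.map fun X => (X ∩ R).ncard ^ 2).sum ≤ M.card * R.ncard ^ 2 := by
    intro M
    refine (Multiset.sum_le_card_nsmul _ (R.ncard ^ 2) ?_).trans (by simp)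
    intro x hx
    obtain ⟨X, -, rfl⟩ := Multiset.mem_map.1 hx
    exact Nat.pow_le_pow_left (Set.ncard_le_ncard Set.inter_subset_right hRfin) 2
  induction hk : M.card * R.ncard ^ 2 - (M.map fun X => (X ∩ R).ncard ^ 2).sum
    using Nat.strong_induction_on generalizing M with
  | _ k ih =>
  by_cases hcf : ∀ X ∈ M, ∀ Y ∈ M, ¬ Crossing X Y
  · exact ⟨M, rfl, hM, fun _ => rfl, hcf⟩
  push Not at hcf
  obtain ⟨X, hX, Y, hY, hXY⟩ := hcf
  obtain ⟨M₁, rfl⟩ := Multiset.exists_cons_of_mem hX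
  have hne : Y ≠ X := by
    rintro rfl
    simpa using hXY.1
  have hY' : Y ∈ M₁ := (Multiset.mem_cons.1 hY).resolve_left hne
  obtain ⟨M₂, rfl⟩ := Multiset.exists_cons_of_mem hY'
  have sX := hM X hX
  have sY := hM Y hY
  -- The cut of `A \ B` is non-empty by connectedness and lies in `D.cut A ∪ D.cut B ⊆ N`, so `A \
  -- B` meets `R`.
  have key : ∀ A B : Set V, D.IsShore A → D.IsShore B → D.cut A ⊆ N → D.cut B ⊆ N →
      (A \ B).Nonempty → (A ∩ B ∩ R).ncard < (A ∩ R).ncard := by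
    intro A B sA sB hA hB hAB
    obtain ⟨e, he⟩ := hD.cut_nonempty hAB
      (sB.nonempty.mono fun x hx h => h.2 hx)
    have heN : e ∈ N := by
      by_contra hc
      have h1 := fun h => hc (hA h)
      have h2 := fun h => hc (hB h)
      simp only [mem_cut_iff, Set.mem_sdiff] at he h1 h2
      tauto
    refine Set.ncard_lt_ncard ⟨fun x hx => ⟨hx.1.1, hx.2⟩, ?_⟩ (hRfin.inter_of_right _)
    intro hs
    by_cases ht : D.tail e ∈ A \ B
    · exact ht.2 (hs ⟨ht.1, Or.inl ⟨e, heN, rfl⟩⟩).1.2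
    · have hh : D.head e ∈ A \ B := by
        rw [mem_cut_iff] at he
        tauto
      exact hh.2 (hs ⟨hh.1, Or.inr ⟨e, heN, rfl⟩⟩).1.2
  have k1 := key X Y sX sY (hMN _ hX) (hMN _ hY) hXY.1
  have k2 := key Y X sY sX (hMN _ hY) (hMN _ hX) hXY.2.1
  rw [Set.inter_comm Y X] at k2
  have k3 : ((X ∪ Y) ∩ R).ncard + (X ∩ Y ∩ R).ncard = (X ∩ R).ncard + (Y ∩ R).ncard := by
    have := Set.ncard_union_add_ncard_inter (X ∩ R) (Y ∩ R) (hRfin.inter_of_right _)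
      (hRfin.inter_of_right _)
    rwa [← Set.union_inter_distrib_right, ← Set.inter_inter_distrib_right] at this
  -- As the two sums of sizes agree, the difference of the sides is `2 * (a - c) * (b - c)`.
  have k4 : (X ∩ R).ncard ^ 2 + (Y ∩ R).ncard ^ 2 <
      (X ∩ Y ∩ R).ncard ^ 2 + ((X ∪ Y) ∩ R).ncard ^ 2 := by
    generalize (X ∩ R).ncard = a at *
    generalize (Y ∩ R).ncard = b at *
    generalize (X ∩ Y ∩ R).ncard = c at *
    generalize ((X ∪ Y) ∩ R).ncard = d at *
    clear hbound ih hk key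
    zify at *
    have hd : (d : ℤ) = a + b - c := by linarith
    rw [hd]
    nlinarith [mul_pos (sub_pos.2 k1) (sub_pos.2 k2)]
  have hcov := cover_uncross sX sY hXY M₂
  have hM' : ∀ Z ∈ (X ∩ Y) ::ₘ (X ∪ Y) ::ₘ M₂, D.IsShore Z := by
    intro Z hZ
    rcases Multiset.mem_cons.1 hZ with rfl | hZ
    · exact sX.inter sY hXY.2.2.1
    rcases Multiset.mem_cons.1 hZ with rfl | hZ
    · exact sX.union sY hXY.2.2.2
    · exact hM Z (by simp [hZ])
  have hMN' : ∀ Z ∈ (X ∩ Y) ::ₘ (X ∪ Y) ::ₘ M₂, D.cut Z ⊆ N := by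
    intro Z hZ e he
    have : 0 < D.cover ((X ∩ Y) ::ₘ (X ∪ Y) ::ₘ M₂) e := cover_pos.2 ⟨Z, hZ, he⟩
    rw [hcov] at this
    obtain ⟨W, hW, heW⟩ := cover_pos.1 this
    exact hMN W hW heW
  have hb := hbound ((X ∩ Y) ::ₘ (X ∪ Y) ::ₘ M₂)
  simp only [Multiset.map_cons, Multiset.sum_cons, Multiset.card_cons] at hb hk
  obtain ⟨M', h1, h2, h3, h4⟩ := ih _ (by
    simp only [Multiset.map_cons, Multiset.sum_cons, Multiset.card_cons]
    omega) _ hM' hMN' rfl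
  exact ⟨M', by simpa using h1, h2, fun e => (h3 e).trans (hcov e), h4⟩

open Classical in
/-- The number of members of `M` that contain `x`. -/
noncomputable def depth (M : Multiset (Set V)) (x : V) : ℤ := M.countP (fun X => x ∈ X)

open Classical in
theorem depth_cons (X : Set V) (M : Multiset (Set V)) (x : V) :
    depth (X ::ₘ M) x = depth M x + if x ∈ X then 1 else 0 := by
  simp [depth, Multiset.countP_cons]

/-- Shores are entered but never left, so contributions along an edge cannot cancel. -/
theorem depth_head_sub_depth_tail {M : Multiset (Set V)} (hM : ∀ X ∈ M, D.IsShore X) (e : E) :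
    depth M (D.head e) - depth M (D.tail e) = D.cover M e := by
  classical
  induction M using Multiset.induction_on with
  | empty => simp [depth, cover]
  | cons X M ih =>
    have hX := hM X (by simp)
    have := ih fun Y hY => hM Y (by simp [hY])
    have h := hX.head_mem e
    rw [depth_cons, depth_cons, cover_cons]
    push_cast
    rw [← this]
    simp only [hX.mem_cut]
    by_cases a : D.head e ∈ X <;> by_cases b : D.tail e ∈ X <;> simp_all
    omega

open Classical in
/-- The side of `X` that avoids `r`. -/
noncomputable def sideAvoiding (r : V) (X : Set V) : Set V := if r ∈ X then Xᶜ else X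

theorem sideAvoiding_laminar (r : V) {X Y : Set V} (h : ¬ Crossing X Y) :
    sideAvoiding r X ⊆ sideAvoiding r Y ∨ sideAvoiding r Y ⊆ sideAvoiding r X ∨
      Disjoint (sideAvoiding r X) (sideAvoiding r Y) := by
  by_contra hc
  push Not at hc
  obtain ⟨h1, h2, h3⟩ := hc
  obtain ⟨a, ha, ha'⟩ := Set.not_subset.1 h1
  obtain ⟨b, hb, hb'⟩ := Set.not_subset.1 h2
  obtain ⟨c, hc, hc'⟩ := Set.not_disjoint_iff.1 h3
  refine h ?_
  unfold sideAvoiding at *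
  by_cases hX : r ∈ X <;> by_cases hY : r ∈ Y <;>
    simp only [hX, hY, if_true, if_false, Set.mem_compl_iff, not_not] at ha ha' hb hb' hc hc'
  · exact ⟨⟨b, by simp_all⟩, ⟨a, by simp_all⟩, ⟨r, by simp_all⟩, ⟨c, by simp_all⟩⟩
  · exact ⟨⟨r, by simp_all⟩, ⟨c, by simp_all⟩, ⟨b, by simp_all⟩, ⟨a, by simp_all⟩⟩
  · exact ⟨⟨c, by simp_all⟩, ⟨r, by simp_all⟩, ⟨a, by simp_all⟩, ⟨b, by simp_all⟩⟩
  · exact ⟨⟨a, by simp_all⟩, ⟨b, by simp_all⟩, ⟨c, by simp_all⟩, ⟨r, by simp_all⟩⟩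

/-- The sides avoiding `r` form a laminar family. Remove an inclusion-minimal one and split the
rest. No remaining set separates two points of the minimal side, so the difference of depths is
constant there, and its value tells which part should receive the removed set. -/
theorem exists_balanced_split (r : V) (M : Multiset (Set V))
    (hM : ∀ X ∈ M, ∀ Y ∈ M, ¬ Crossing X Y) :
    ∃ P Q : Multiset (Set V), P + Q = M ∧
      ∃ c : ℤ, ∀ x, depth P x - depth Q x = c ∨ depth P x - depth Q x = c + 1 := by
  classical
  induction hk : M.card generalizing M with
  | zero =>
    rw [Multiset.card_eq_zero] at hk
    exact ⟨0, 0, by simp [hk], 0, by simp [depth]⟩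
  | succ k ih =>
    have hne : (sideAvoiding r '' {X | X ∈ M}).Nonempty := by
      obtain ⟨X, hX⟩ := Multiset.card_pos_iff_exists_mem.1 (by omega : 0 < M.card)
      exact ⟨_, X, hX, rfl⟩
    have hfin : {X | X ∈ M}.Finite := by
      exact M.toFinset.finite_toSet.subset fun X hX => by simpa using hX
    obtain ⟨Z, ⟨hZ, hmin⟩⟩ := (hfin.image (sideAvoiding r)).exists_minimal hne
    obtain ⟨X, hX, rfl⟩ := hZ
    obtain ⟨M, rfl⟩ := Multiset.exists_cons_of_mem hX
    obtain ⟨P, Q, rfl, c, hc⟩ := ih M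
      (fun A hA B hB => hM A (by simp [hA]) B (by simp [hB])) (by simpa using hk)
    have hsup : ∀ Y ∈ P + Q, ∀ x ∈ sideAvoiding r X, ∀ y ∈ sideAvoiding r X,
        (x ∈ Y ↔ y ∈ Y) := by
      intro Y hY
      have : ∀ x ∈ sideAvoiding r X, ∀ y ∈ sideAvoiding r X,
          x ∈ sideAvoiding r Y → y ∈ sideAvoiding r Y := by
        intro x hx y hy hxY
        rcases sideAvoiding_laminar r (hM X (by simp) Y (Multiset.mem_cons_of_mem hY))
          with h | h | h
        · exact h hy
        · exact hmin ⟨Y, Multiset.mem_cons_of_mem hY, rfl⟩ h hy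
        · exact (Set.disjoint_left.1 h hx hxY).elim
      intro x hx y hy
      have h1 := this x hx y hy
      have h2 := this y hy x hx
      by_cases hr : r ∈ Y
      · simp only [sideAvoiding, hr, if_true, Set.mem_compl_iff] at h1 h2
        tauto
      · simp only [sideAvoiding, hr, if_false] at h1 h2
        exact ⟨h1, h2⟩
    have hconst : ∀ x ∈ sideAvoiding r X, ∀ y ∈ sideAvoiding r X,
        depth P x - depth Q x = depth P y - depth Q y := by
      intro x hx y hy
      have h1 : depth P x = depth P y := by
        unfold depth
        exact congrArg _ (Multiset.countP_congr rfl fun Y hY => by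
          simpa using hsup Y (by simp [hY]) x hx y hy)
      have h2 : depth Q x = depth Q y := by
        unfold depth
        exact congrArg _ (Multiset.countP_congr rfl fun Y hY => by
          simpa using hsup Y (by simp [hY]) x hx y hy)
      rw [h1, h2]
    have hval : (∀ x ∈ sideAvoiding r X, depth P x - depth Q x = c) ∨
        (∀ x ∈ sideAvoiding r X, depth P x - depth Q x = c + 1) := by
      by_cases h : ∃ x ∈ sideAvoiding r X, depth P x - depth Q x = c
      · obtain ⟨x, hx, h⟩ := h
        exact Or.inl fun y hy => (hconst y hy x hx).trans h
      · push Not at h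
        exact Or.inr fun y hy => (hc y).resolve_left (h y hy)
    have hP : (X ::ₘ P) + Q = X ::ₘ (P + Q) := by simp
    have hQ : P + (X ::ₘ Q) = X ::ₘ (P + Q) := by simp
    -- If `r ∈ X`, the minimal side is `Xᶜ`, so adding `X` changes the depth off that side and `c`
    -- shifts by one.
    by_cases hr : r ∈ X <;> simp only [sideAvoiding, hr, if_true, if_false] at hval <;>
      rcases hval with hval | hval
    · refine ⟨P, X ::ₘ Q, hQ, c - 1, fun x => ?_⟩
      rw [depth_cons]
      have h1 := hval x
      have h2 := hc x
      by_cases hx : x ∈ X <;> simp only [hx, Set.mem_compl_iff, not_true, not_false_eq_true,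
        forall_const, if_true, if_false] at h1 ⊢ <;> omega
    · refine ⟨X ::ₘ P, Q, hP, c + 1, fun x => ?_⟩
      rw [depth_cons]
      have h1 := hval x
      have h2 := hc x
      by_cases hx : x ∈ X <;> simp only [hx, Set.mem_compl_iff, not_true, not_false_eq_true,
        forall_const, if_true, if_false] at h1 ⊢ <;> omega
    · refine ⟨X ::ₘ P, Q, hP, c, fun x => ?_⟩
      rw [depth_cons]
      have h1 := hval x
      have h2 := hc x
      by_cases hx : x ∈ X <;> simp only [hx, forall_const, if_true, if_false] at h1 ⊢ <;> omega
    · refine ⟨P, X ::ₘ Q, hQ, c, fun x => ?_⟩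
      rw [depth_cons]
      have h1 := hval x
      have h2 := hc x
      by_cases hx : x ∈ X <;> simp only [hx, forall_const, if_true, if_false] at h1 ⊢ <;> omega

/-! ### The Lucchesi–Younger theorem -/

/-- `M` is a multiset of shores whose cuts cover every edge `e` at most `w e` times. -/
structure IsPacking (D : MultiDigraph V E) (w : E → ℕ) (M : Multiset (Set V)) : Prop where
  isShore : ∀ X ∈ M, D.IsShore X
  cover_le : ∀ e, D.cover M e ≤ w e

theorem IsPacking.add {w w' : E → ℕ} {M M' : Multiset (Set V)} (h : D.IsPacking w M)
    (h' : D.IsPacking w' M') : D.IsPacking (w + w') (M + M') where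
  isShore X hX := (Multiset.mem_add.1 hX).elim (h.isShore X) (h'.isShore X)
  cover_le e := by
    rw [cover_add]
    exact add_le_add (h.cover_le e) (h'.cover_le e)

theorem IsPacking.mono {w w' : E → ℕ} {M : Multiset (Set V)} (h : D.IsPacking w M)
    (hw : ∀ e, w e ≤ w' e) : D.IsPacking w' M :=
  ⟨h.isShore, fun e => (h.cover_le e).trans (hw e)⟩

theorem IsPacking.cut_subset {w : E → ℕ} {M : Multiset (Set V)} (h : D.IsPacking w M)
    {S : Set E} (hS : ∀ e, e ∉ S → w e = 0) {X : Set V} (hX : X ∈ M) : D.cut X ⊆ S := by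
  intro e he
  by_contra hc
  have h1 := h.cover_le e
  have h2 : 0 < D.cover M e := cover_pos.2 ⟨X, hX, he⟩
  have := hS e hc
  omega

open Classical in
theorem sum_cover (S : Finset E) (M : Multiset (Set V)) :
    ∑ e ∈ S, D.cover M e = (M.map fun X => (S.filter (· ∈ D.cut X)).card).sum := by
  induction M using Multiset.induction_on with
  | empty => simp [cover]
  | cons X M ih =>
    simp only [cover_cons, Finset.sum_add_distrib, ih, Multiset.map_cons, Multiset.sum_cons,
      Finset.card_filter]
    exact add_comm _ _

theorem card_le_sum_cover {F : Finset E} {M : Multiset (Set V)}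
    (hF : ∀ X ∈ M, ((F : Set E) ∩ D.cut X).Nonempty) : M.card ≤ ∑ e ∈ F, D.cover M e := by
  classical
  rw [sum_cover]
  have := Multiset.card_nsmul_le_sum (s := M.map fun X => (F.filter (· ∈ D.cut X)).card)
    (a := 1) (by
      intro x hx
      obtain ⟨X, hX, rfl⟩ := Multiset.mem_map.1 hx
      obtain ⟨e, he, he'⟩ := hF X hX
      exact Finset.card_pos.2 ⟨e, Finset.mem_filter.2 ⟨he, he'⟩⟩)
  simpa using this

/-- After uncrossing, a balanced split makes the covers of any edge by `P` and `Q` differ by at most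
one. Their sum is at most `2 * w e`, so each is at most `w e`. -/
theorem IsPacking.exists_half (hD : D.WeaklyConnected) {w : E → ℕ} {S : Finset E}
    (hw : ∀ e ∉ S, w e = 0) {M : Multiset (Set V)} (hM : D.IsPacking (w + w) M) {k : ℕ}
    (hk : 2 * k < M.card) : ∃ P, D.IsPacking w P ∧ k < P.card := by
  obtain ⟨M', hcard, hsh, hcov, hcf⟩ := exists_crossFree hD S.finite_toSet M hM.isShore
    fun X hX => hM.cut_subset (S := S) (by
      intro e he
      simp [hw e (by simpa using he)]) hX
  obtain ⟨r⟩ := hD.1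
  obtain ⟨P, Q, rfl, c, hc⟩ := exists_balanced_split r M' hcf
  have hP : ∀ X ∈ P, D.IsShore X := fun X hX => hsh X (by simp [hX])
  have hQ : ∀ X ∈ Q, D.IsShore X := fun X hX => hsh X (by simp [hX])
  have key : ∀ e, D.cover P e ≤ w e ∧ D.cover Q e ≤ w e := by
    intro e
    have h1 := hM.cover_le e
    rw [← hcov, cover_add, Pi.add_apply] at h1
    have h2 := depth_head_sub_depth_tail hP e
    have h3 := depth_head_sub_depth_tail hQ e
    have h4 := hc (D.head e)
    have h5 := hc (D.tail e)
    omega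
  rw [← hcard, Multiset.card_add] at hk
  rcases lt_or_ge k P.card with h | h
  · exact ⟨P, ⟨hP, fun e => (key e).1⟩, h⟩
  · exact ⟨Q, ⟨hQ, fun e => (key e).2⟩, by omega⟩

open Classical in
/-- The indicator function of a finite set of edges. -/
noncomputable def weight (S : Finset E) (e : E) : ℕ := if e ∈ S then 1 else 0

theorem IsPacking.card_le {S : Finset E} {M : Multiset (Set V)}
    (hM : D.IsPacking (weight S) M) {F : Finset E}
    (hF : ∀ X, D.IsShore X → D.cut X ⊆ S → ((F : Set E) ∩ D.cut X).Nonempty) :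
    M.card ≤ F.card := by
  refine (card_le_sum_cover fun X hX => hF X (hM.isShore X hX) ?_).trans ?_
  · exact hM.cut_subset (by
      intro e he
      simpa [weight] using he) hX
  · calc ∑ e ∈ F, D.cover M e ≤ ∑ e ∈ F, 1 := by
          refine Finset.sum_le_sum fun e _ => (hM.cover_le e).trans ?_
          unfold weight
          split_ifs <;> omega
      _ = F.card := by simp

/-- If deleting some edge `b` lowers the packing number, induction gives a cover for `S.erase b`,
and `b` is added to it. Otherwise no deletion lowers it, and doubling the edges one at a time never
raises it; but doubling all of `S` allows two copies of an optimal packing, so that packing is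
empty. -/
theorem lucchesi_younger (hD : D.WeaklyConnected) (S : Finset E) :
    ∃ (F : Finset E) (M : Multiset (Set V)), F ⊆ S ∧ D.IsPacking (weight S) M ∧
      M.card = F.card ∧
      ∀ X, D.IsShore X → D.cut X ⊆ S → ((F : Set E) ∩ D.cut X).Nonempty := by
  classical
  induction S using Finset.strongInduction with
  | H S ih =>
  have hS : ∀ X, D.IsShore X → D.cut X ⊆ S → ((S : Set E) ∩ D.cut X).Nonempty := fun X hX h =>
    (hD.cut_nonempty hX.nonempty hX.compl_nonempty).mono fun e he => ⟨h he, he⟩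
  obtain ⟨M₀, hM₀, hmax⟩ : ∃ M, D.IsPacking (weight S) M ∧
      ∀ M', D.IsPacking (weight S) M' → M'.card ≤ M.card := by
    set K : Set ℕ := {k | ∃ M, D.IsPacking (weight S) M ∧ M.card = k} with hK
    have hb : BddAbove K := ⟨S.card, by
      rintro k ⟨M, hM, rfl⟩
      exact hM.card_le hS⟩
    obtain ⟨M, hM, hcard⟩ := Nat.sSup_mem (s := K) ⟨0, 0, ⟨by simp, by simp [cover]⟩, rfl⟩ hb
    exact ⟨M, hM, fun M' hM' => hcard ▸ le_csSup hb ⟨M', hM', rfl⟩⟩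
  suffices h : ∃ F ⊆ S, F.card ≤ M₀.card ∧
      ∀ X, D.IsShore X → D.cut X ⊆ S → ((F : Set E) ∩ D.cut X).Nonempty by
    obtain ⟨F, hFS, hF, hFX⟩ := h
    exact ⟨F, M₀, hFS, hM₀, (hM₀.card_le hFX).antisymm hF, hFX⟩
  by_cases hcrit : ∃ b ∈ S, ∀ M, D.IsPacking (weight (S.erase b)) M → M.card < M₀.card
  · obtain ⟨b, hb, hcrit⟩ := hcrit
    obtain ⟨F, M, hFS, hM, hMF, hF⟩ := ih _ (Finset.erase_ssubset hb)
    refine ⟨insert b F, Finset.insert_subset hb (hFS.trans (Finset.erase_subset _ _)), ?_, ?_⟩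
    · have := hcrit M hM
      have := Finset.card_insert_le b F
      omega
    · intro X hX hXS
      by_cases hbX : b ∈ D.cut X
      · exact ⟨b, by simp, hbX⟩
      · refine (hF X hX fun e he => ?_).mono fun e he => ⟨by simpa using Or.inr he.1, he.2⟩
        exact Finset.mem_coe.2 (Finset.mem_erase.2 ⟨fun h => hbX (h ▸ he), hXS he⟩)
  push Not at hcrit
  rcases Nat.eq_zero_or_pos M₀.card with h0 | hpos
  · refine ⟨∅, by simp, by simp, fun X hX hXS => ?_⟩
    have := hmax {X} ⟨by simpa using hX, fun e => by
      have : D.cover {X} e = if e ∈ D.cut X then 1 else 0 := by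
        rw [← Multiset.cons_zero, cover_cons]
        simp [cover]
      rw [this, weight]
      have := @hXS e
      split_ifs <;> simp_all⟩
    simp [h0] at this
  exfalso
  have hT : ∀ T ⊆ S, ∀ M, D.IsPacking (weight S + weight T) M → M.card ≤ M₀.card := by
    intro T
    induction T using Finset.induction_on with
    | empty =>
      intro _ M hM
      exact hmax M (hM.mono fun e => by simp [weight])
    | insert b T hbT ihT =>
      intro hT M₁ hM₁
      by_contra! hlt
      obtain ⟨hb, hT⟩ := Finset.insert_subset_iff.1 hT
      obtain ⟨M₂, hM₂, hk⟩ := hcrit b hb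
      -- At `b` the weights add up to `2 + 0 = 2 * 1`: the edge missing from `M₂` pays for the one
      -- doubled in `M₁`.
      have hM : D.IsPacking ((weight S + weight T) + (weight S + weight T)) (M₁ + M₂) := by
        refine (hM₁.add hM₂).mono fun e => ?_
        simp only [Pi.add_apply, weight, Finset.mem_insert, Finset.mem_erase]
        have := @hT e
        by_cases h1 : e = b
        · subst h1
          simp [hb, hbT]
        · by_cases h2 : e ∈ S <;> by_cases h3 : e ∈ T <;> simp_all
      obtain ⟨P, hP, hlt'⟩ := hM.exists_half hD (S := S) (k := M₀.card) (by
        intro e he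
        have : e ∉ T := fun h => he (hT h)
        simp [weight, he, this]) (by
        rw [Multiset.card_add]
        omega)
      exact absurd (ihT hT P hP) (by omega)
  have := hT S subset_rfl _ (hM₀.add hM₀)
  rw [Multiset.card_add] at this
  omega

/-! ### Connectivity inside a set of vertices -/

/-- `b` can be reached from `a` by an undirected walk inside `K`. -/
def ConnIn (D : MultiDigraph V E) (K : Set V) : V → V → Prop :=
  Relation.ReflTransGen fun a b => a ∈ K ∧ b ∈ K ∧ ∃ e, D.Joins e a b

theorem Joins.symm {e : E} {a b : V} (h : D.Joins e a b) : D.Joins e b a :=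
  h.elim Or.inr Or.inl

theorem ConnIn.symm {K : Set V} {a b : V} (h : D.ConnIn K a b) : D.ConnIn K b a := by
  induction h with
  | refl => exact .refl
  | tail _ h ih => exact .head ⟨h.2.1, h.1, h.2.2.imp fun _ => Joins.symm⟩ ih

theorem ConnIn.mono {K L : Set V} (hKL : K ⊆ L) {a b : V} (h : D.ConnIn K a b) :
    D.ConnIn L a b :=
  Relation.ReflTransGen.mono (fun _ _ h => ⟨hKL h.1, hKL h.2.1, h.2.2⟩) _ _ h

theorem ConnIn.step {K : Set V} {a b : V} (ha : a ∈ K) (hb : b ∈ K) {e : E}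
    (h : D.Joins e a b) : D.ConnIn K a b :=
  .single ⟨ha, hb, e, h⟩

/-- The component of `a` in the subgraph induced by `K`. -/
def component (D : MultiDigraph V E) (K : Set V) (a : V) : Set V := {b | b ∈ K ∧ D.ConnIn K a b}

theorem component_subset (K : Set V) (a : V) : D.component K a ⊆ K := fun _ h => h.1

theorem self_mem_component {K : Set V} {a : V} (ha : a ∈ K) : a ∈ D.component K a := ⟨ha, .refl⟩

/-- The subgraph induced by `K` is connected (or `K` is empty). -/
def ConnectedOn (D : MultiDigraph V E) (K : Set V) : Prop := ∀ a ∈ K, ∀ b ∈ K, D.ConnIn K a b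

theorem ConnIn.component {K : Set V} {a b : V} (h : D.ConnIn K a b) :
    D.ConnIn (D.component K a) a b := by
  induction h with
  | refl => exact .refl
  | tail hab h ih => exact .tail ih ⟨⟨h.1, hab⟩, ⟨h.2.1, hab.tail h⟩, h.2.2⟩

theorem connectedOn_component (K : Set V) (a : V) : D.ConnectedOn (D.component K a) :=
  fun _ hb _ hc => hb.2.component.symm.trans hc.2.component

theorem mem_component_of_joins {K : Set V} {a b c : V} (hb : b ∈ D.component K a) (hc : c ∈ K)
    {e : E} (h : D.Joins e b c) : c ∈ D.component K a :=
  ⟨hc, hb.2.trans (ConnIn.step hb.1 hc h)⟩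

theorem joins_tail_head (e : E) : D.Joins e (D.tail e) (D.head e) := Or.inl ⟨rfl, rfl⟩

theorem WeaklyConnected.connectedOn_univ (hD : D.WeaklyConnected) : D.ConnectedOn Set.univ :=
  fun a _ b _ => Relation.ReflTransGen.mono (fun _ _ h => ⟨trivial, trivial, h⟩) _ _ (hD.2 a b)

/-- The cut around a component of `K` consists of edges of the cut around `K`. -/
theorem cut_component_subset (K : Set V) (a : V) : D.cut (D.component K a) ⊆ D.cut K := by
  intro e he
  rw [mem_cut_iff] at he ⊢
  by_cases ht : D.tail e ∈ D.component K a
  · have hh := he.1 ht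
    exact iff_of_true ht.1 fun hc => hh (mem_component_of_joins ht hc (joins_tail_head e))
  · have hh : D.head e ∈ D.component K a := by tauto
    refine iff_of_false (fun hc => ht ?_) (fun h => h hh.1)
    exact mem_component_of_joins hh hc (joins_tail_head e).symm

/-- All edges of the cut around `A` point in the same direction. -/
def IsDirected (D : MultiDigraph V E) (A : Set V) : Prop :=
  (∀ e, D.tail e ∈ A → D.head e ∈ A) ∨ ∀ e, D.head e ∈ A → D.tail e ∈ A

theorem IsShore.isDirected {X : Set V} (hX : D.IsShore X) : D.IsDirected X := Or.inl hX.head_mem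

theorem IsDirected.compl {A : Set V} (hA : D.IsDirected A) : D.IsDirected Aᶜ :=
  hA.symm.imp (fun h e ht hh => ht (h e hh)) fun h e hh ht => hh (h e ht)

theorem IsDirected.isDicut {A : Set V} (hA : D.IsDirected A) : D.IsDicut (D.cut A) := by
  rcases hA with h | h
  · refine ⟨A, rfl, fun e he => ?_⟩
    have := h e
    rw [mem_cut_iff] at he
    tauto
  · refine ⟨Aᶜ, (cut_compl A).symm, fun e he => ?_⟩
    have := h e
    rw [mem_cut_iff] at he
    rw [Set.mem_compl_iff]
    tauto

theorem IsDirected.of_cut_subset {A K : Set V} (hA : D.IsDirected A) (hK : K ⊆ A)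
    (hKA : D.cut K ⊆ D.cut A) : D.IsDirected K := by
  refine hA.imp (fun h e he => ?_) fun h e he => ?_
  · by_contra hc
    exact (mem_cut_iff.1 (hKA (mem_cut_iff.2 (iff_of_true he hc)))).1 (hK he) (h e (hK he))
  · by_contra hc
    have := mem_cut_iff.1 (hKA (mem_cut_iff.2 (iff_of_false hc (not_not.2 he))))
    exact this.1 (h e (hK he)) (hK he)

theorem IsDirected.component {A : Set V} (hA : D.IsDirected A) (a : V) :
    D.IsDirected (D.component A a) :=
  hA.of_cut_subset (component_subset A a) (cut_component_subset A a)

/-- The cuts around two different components would be disjoint non-empty dicuts inside the dibond,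
against minimality. -/
theorem IsDibond.connectedOn (hD : D.WeaklyConnected) {A : Set V} (hB : D.IsDibond (D.cut A))
    (hA : D.IsDirected A) : D.ConnectedOn A := by
  intro a ha b hb
  by_contra hab
  set K := D.component A a
  set L := D.component A b
  have haK : a ∈ K := self_mem_component ha
  have hbL : b ∈ L := self_mem_component hb
  have hKL : ∀ x ∈ K, x ∉ L := fun x hx hx' => hab (hx.2.trans hx'.2.symm)
  have hKne : (D.cut K).Nonempty := hD.cut_nonempty ⟨a, haK⟩ ⟨b, fun h => hKL b h hbL⟩
  have hLne : (D.cut L).Nonempty := hD.cut_nonempty ⟨b, hbL⟩ ⟨a, hKL a haK⟩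
  obtain ⟨e, he⟩ := hLne
  have heA := cut_component_subset A b he
  have heK : e ∈ D.cut K :=
    hB.2 ⟨(hA.component a).isDicut, hKne⟩ (cut_component_subset A a) heA
  have h1 := hKL (D.tail e)
  have h2 := hKL (D.head e)
  have h3 := @component_subset _ _ D A a (D.tail e)
  have h4 := @component_subset _ _ D A a (D.head e)
  have h5 := @component_subset _ _ D A b (D.tail e)
  have h6 := @component_subset _ _ D A b (D.head e)
  rw [mem_cut_iff] at he heA heK
  tauto

/-- A walk inside `A` uses no edge of `D.cut A`, hence cannot cross `Z`. -/
theorem ConnectedOn.subset_or_disjoint {A Z : Set V} (hA : D.ConnectedOn A)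
    (hZ : D.cut Z ⊆ D.cut A) : A ⊆ Z ∨ Disjoint A Z := by
  by_contra! h
  obtain ⟨a, ha, haZ⟩ := Set.not_subset.1 h.1
  obtain ⟨b, hb, hbZ⟩ := Set.not_disjoint_iff.1 h.2
  have : ∀ c, D.ConnIn A a c → c ∉ Z := by
    intro c hc
    induction hc with
    | refl => exact haZ
    | tail _ h ih =>
      obtain ⟨hx, hy, e, he⟩ := h
      intro hc
      have heZ : e ∈ D.cut Z := by
        rw [mem_cut_iff]
        rcases he with ⟨rfl, rfl⟩ | ⟨rfl, rfl⟩ <;> tauto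
      have := mem_cut_iff.1 (hZ heZ)
      rcases he with ⟨rfl, rfl⟩ | ⟨rfl, rfl⟩ <;> tauto
  exact this b (hA a ha b hb) hbZ

theorem IsDirected.isDibond {A : Set V} (hA : D.IsDirected A) (hne : (D.cut A).Nonempty)
    (h₁ : D.ConnectedOn A) (h₂ : D.ConnectedOn Aᶜ) : D.IsDibond (D.cut A) := by
  refine ⟨⟨hA.isDicut, hne⟩, ?_⟩
  rintro _ ⟨⟨Z, rfl, -⟩, e, he⟩ hZ
  suffices h : Z = A ∨ Z = Aᶜ by
    rcases h with rfl | rfl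
    · exact subset_rfl
    · exact (cut_compl A).ge
  rw [mem_cut_iff] at he
  rcases h₁.subset_or_disjoint hZ with h | h <;>
    rcases h₂.subset_or_disjoint (hZ.trans (cut_compl A).ge) with h' | h'
  · have hall : ∀ x, x ∈ Z := fun x => (em (x ∈ A)).elim (@h x) (@h' x)
    have := hall (D.tail e)
    have := hall (D.head e)
    tauto
  · exact Or.inl (Set.Subset.antisymm (Set.disjoint_compl_left_iff_subset.1 h') h)
  · exact Or.inr (Set.Subset.antisymm (Set.subset_compl_iff_disjoint_left.2 h) h')
  · have hall : ∀ x, x ∉ Z := fun x => (em (x ∈ A)).elim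
      (fun hx => Set.disjoint_left.1 h hx) (fun hx => Set.disjoint_left.1 h' hx)
    have := hall (D.tail e)
    have := hall (D.head e)
    tauto

/-- If `K` is connected, the complement of every component of its complement is connected. -/
theorem connectedOn_compl_component_compl (hD : D.WeaklyConnected) {K : Set V} {h : V}
    (hh : h ∈ K) (hK : D.ConnectedOn K) (a : V) : D.ConnectedOn (D.component Kᶜ a)ᶜ := by
  set A := D.component Kᶜ a
  have hKA : K ⊆ Aᶜ := fun x hx hxA => hxA.1 hx
  have key : ∀ b, b ∈ A ∨ D.ConnIn Aᶜ h b := by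
    intro b
    induction hD.2 h b with
    | refl => exact Or.inr .refl
    | @tail x y _ hxy ih =>
      obtain ⟨e, he⟩ := hxy
      by_cases hy : y ∈ A
      · exact Or.inl hy
      right
      by_cases hyK : y ∈ K
      · exact (hK h hh y hyK).mono hKA
      · have hxA : x ∉ A := fun hx => hy (mem_component_of_joins hx hyK he)
        exact (ih.resolve_left hxA).trans (ConnIn.step hxA hy he)
  exact fun x hx y hy => ((key x).resolve_left hx).symm.trans ((key y).resolve_left hy)

/-- An infinite dicut need not shrink to a minimal one by descent, so the dibond is built directly:
passing to a component, then to a component of the complement, makes both sides connected. -/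
theorem IsShore.exists_isDibond_subset (hD : D.WeaklyConnected) {X : Set V} (hX : D.IsShore X) :
    ∃ B ⊆ D.cut X, D.IsDibond B := by
  obtain ⟨e, he⟩ := hD.cut_nonempty hX.nonempty hX.compl_nonempty
  rw [hX.mem_cut] at he
  set K := D.component X (D.head e)
  have hK : D.head e ∈ K := self_mem_component he.1
  set A := D.component Kᶜ (D.tail e)
  have htA : D.tail e ∈ A := self_mem_component fun h => he.2 h.1
  refine ⟨D.cut A, ?_, IsDirected.isDibond ?_ ⟨e, ?_⟩ (connectedOn_component _ _)
    (connectedOn_compl_component_compl hD hK (connectedOn_component _ _) _)⟩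
  · exact (cut_component_subset _ _).trans ((cut_compl K).le.trans (cut_component_subset _ _))
  · exact ((hX.isDirected.component _).compl).component _
  · exact mem_cut_iff.2 (iff_of_true htA fun h => h.1 hK)

/-! ### Limits of finite dibonds -/

/-- If `e` lies in infinitely many finite dibonds, then a limit of the shores of these dibonds is a
shore with an infinite cut that contains no finite dicut. -/
theorem exists_limit_shore {e : E}
    (he : {B : Set E | D.IsDibond B ∧ B.Finite ∧ e ∈ B}.Infinite) :
    ∃ (ι : Type v) (u : Ultrafilter ι) (X : ι → Set V),
      (∀ i, D.IsShore (X i) ∧ D.IsDibond (D.cut (X i)) ∧ (D.cut (X i)).Finite) ∧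
      D.IsShore {x | ∀ᶠ i in u, x ∈ X i} ∧
      ∀ B ⊆ D.cut {x | ∀ᶠ i in u, x ∈ X i}, D.IsDicut B → B.Nonempty → B.Infinite := by
  set 𝒟 := {B : Set E | D.IsDibond B ∧ B.Finite ∧ e ∈ B}
  have : Infinite 𝒟 := he.to_subtype
  have hX : ∀ B : 𝒟, ∃ X, D.IsShore X ∧ (B : Set E) = D.cut X := fun B =>
    B.2.1.1.1.exists_isShore B.2.1.1.2
  choose X hX hcut using hX
  set u : Ultrafilter 𝒟 := Filter.hyperfilter 𝒟
  have hshore : D.IsShore {x | ∀ᶠ i in u, x ∈ X i} := by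
    have h : ∀ i, D.head e ∈ X i ∧ D.tail e ∉ X i := fun i =>
      (hX i).mem_cut.1 (hcut i ▸ i.2.2.2)
    refine ⟨⟨D.head e, .of_forall fun i => (h i).1⟩, ⟨D.tail e, fun hc => ?_⟩, ?_⟩
    · obtain ⟨i, hi⟩ := Filter.Eventually.exists (f := (u : Filter 𝒟)) hc
      exact (h i).2 hi
    · exact fun f hf => Filter.Eventually.mono hf fun i hi => (hX i).head_mem f hi
  refine ⟨𝒟, u, X, fun i => ⟨hX i, hcut i ▸ i.2.1, hcut i ▸ i.2.2.1⟩, hshore, ?_⟩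
  intro B hB hdi hne hfin
  have h1 : ∀ᶠ i in u, ∀ f ∈ B, f ∈ D.cut (X i) := by
    refine (Filter.eventually_all_finite hfin).2 fun f hf => ?_
    have h := hshore.mem_cut.1 (hB hf)
    have h2 : ∀ᶠ i in u, D.tail f ∉ X i := Ultrafilter.eventually_not.2 h.2
    filter_upwards [h.1, h2] with i hi hi'
    exact (hX i).mem_cut.2 ⟨hi, hi'⟩
  -- By minimality, a dibond containing the dicut `B` equals `B`; a non-principal ultrafilter cannot
  -- concentrate on one dibond.
  have h2 : ∀ᶠ i : 𝒟 in u, (i : Set E) = B := by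
    filter_upwards [h1] with i hi
    rw [← hcut i] at hi
    exact Set.Subset.antisymm (i.2.1.2 ⟨hdi, hne⟩ hi) hi
  obtain ⟨i, hi⟩ := h2.exists
  have h3 : ∀ᶠ j in u, j ≠ i := Filter.hyperfilter_le_cofinite (by simp)
  obtain ⟨j, hj, hj'⟩ := (h2.and h3).exists
  exact hj' (Subtype.ext (hj.trans hi.symm))

theorem finite_dibonds_of_forall_dibond_finite (hD : D.WeaklyConnected)
    (h : ∀ B, D.IsDibond B → B.Finite) (e : E) :
    {B : Set E | D.IsDibond B ∧ B.Finite ∧ e ∈ B}.Finite := by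
  by_contra hc
  obtain ⟨ι, u, X, -, hL, hinf⟩ := exists_limit_shore hc
  obtain ⟨B, hB, hbond⟩ := hL.exists_isDibond_subset hD
  exact hinf B hB hbond.1.1 hbond.1.2 (h B hbond)

/-! ### Rayless digraphs -/

theorem ConnIn.eq_or_exists_neighbour {K : Set V} {v b : V} (h : D.ConnIn K v b) :
    b = v ∨ ∃ w ∈ K \ {v}, (∃ e, D.Joins e v w) ∧ D.ConnIn (K \ {v}) w b := by
  induction h with
  | refl => exact Or.inl rfl
  | @tail x y _ hxy ih =>
    obtain ⟨hx, hy, e, he⟩ := hxy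
    by_cases hyv : y = v
    · exact Or.inl hyv
    right
    by_cases hxv : x = v
    · subst hxv
      exact ⟨y, ⟨hy, hyv⟩, ⟨e, he⟩, .refl⟩
    · obtain ⟨w, hw, hvw, hwx⟩ := ih.resolve_left hxv
      exact ⟨w, hw, hvw, hwx.trans (ConnIn.step ⟨hx, hxv⟩ ⟨hy, hyv⟩ he)⟩

theorem ConnIn.exists_cut_edge {K Z : Set V} {v b : V} (h : D.ConnIn K v b) (hv : v ∈ Z) :
    b ∈ Z ∨ ∃ f ∈ D.cut Z,
      b ∈ D.component (K \ {v}) (D.tail f) ∪ D.component (K \ {v}) (D.head f) := by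
  induction h with
  | refl => exact Or.inl hv
  | @tail x y _ hxy ih =>
    obtain ⟨hx, hy, e, he⟩ := hxy
    by_cases hyZ : y ∈ Z
    · exact Or.inl hyZ
    right
    have hyK : y ∈ K \ {v} := ⟨hy, fun h => hyZ (by rwa [Set.mem_singleton_iff.1 h])⟩
    by_cases hxZ : x ∈ Z
    · refine ⟨e, ?_, ?_⟩
      · rw [mem_cut_iff]
        rcases he with ⟨rfl, rfl⟩ | ⟨rfl, rfl⟩ <;> tauto
      · rcases he with ⟨rfl, rfl⟩ | ⟨rfl, rfl⟩
        · exact Or.inr (self_mem_component hyK)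
        · exact Or.inl (self_mem_component hyK)
    · obtain ⟨f, hf, hxf⟩ := ih.resolve_left hxZ
      exact ⟨f, hf, hxf.imp (fun h => mem_component_of_joins h hyK he)
        fun h => mem_component_of_joins h hyK he⟩

/-- In a rayless digraph, every ultrafilter on the vertices that contains a connected set `W`
converges to a vertex of `W`, in the topology generated by the sides of finite cuts. -/
theorem Rayless.exists_dominating (hray : D.Rayless) (u : Ultrafilter V) {W : Set V}
    (hW : D.ConnectedOn W) (hWu : W ∈ u) :
    ∃ c ∈ W, ∀ Z, (D.cut Z).Finite → c ∈ Z → Z ∈ u := by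
  by_contra! hcon
  -- A ray is built from pairs of a connected set in `u` and a current vertex in it; each next set
  -- omits the current vertex.
  let State := {p : Set V × V // p.2 ∈ p.1 ∧ D.ConnectedOn p.1 ∧ p.1 ∈ u ∧ p.1 ⊆ W}
  have step : ∀ p : State, ∃ q : State, q.1.1 ⊆ p.1.1 \ {p.1.2} ∧ ∃ e, D.Joins e p.1.2 q.1.2 := by
    rintro ⟨⟨K, v⟩, hv, hK, hKu, hKW⟩
    dsimp only at hv hK hKu hKW
    obtain ⟨Z, hZ, hvZ, hZu⟩ := hcon v (hKW hv)
    obtain ⟨x, hx⟩ : ∃ x, D.component (K \ {v}) x ∈ u := by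
      by_contra! hno
      have h1 : K ∩ Zᶜ ∈ u := Filter.inter_mem hKu (Ultrafilter.compl_mem_iff_notMem.2 hZu)
      -- To leave `Z`, a walk from `v` uses an edge of the finite cut, so finitely many components
      -- of `K \ {v}` cover `K \ Z`.
      have h2 : (⋃ f ∈ D.cut Z, (D.component (K \ {v}) (D.tail f) ∪
          D.component (K \ {v}) (D.head f))) ∈ u := by
        refine Filter.mem_of_superset h1 fun b hb => ?_
        simpa using (hK v hv b hb.1).exists_cut_edge hvZ |>.resolve_left hb.2
      obtain ⟨f, -, hf⟩ := (Ultrafilter.finite_biUnion_mem_iff hZ).1 h2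
      exact (Ultrafilter.union_mem_iff.1 hf).elim (hno _) (hno _)
    obtain ⟨b, hb⟩ := u.nonempty_of_mem hx
    obtain ⟨w, hw, hvw, hwb⟩ := (hK v hv b hb.1.1).eq_or_exists_neighbour.resolve_left hb.1.2
    refine ⟨⟨⟨D.component (K \ {v}) w, w⟩, self_mem_component hw, connectedOn_component _ _,
      Filter.mem_of_superset hx fun y hy => ⟨hy.1, hwb.trans (hb.2.symm.trans hy.2)⟩,
      (component_subset _ _).trans (Set.sdiff_subset.trans hKW)⟩, component_subset _ _, hvw⟩
  choose next hnext hadj using step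
  obtain ⟨w, hw⟩ := u.nonempty_of_mem hWu
  let s : ℕ → State := fun n => next^[n] ⟨(W, w), hw, hW, hWu, subset_rfl⟩
  have hs : ∀ n, s (n + 1) = next (s n) := fun n => Function.iterate_succ_apply' _ _ _
  have hanti : Antitone fun n => (s n).1.1 := antitone_nat_of_succ_le fun n => by
    rw [hs]
    exact (hnext _).trans Set.sdiff_subset
  have hne : ∀ m n, m < n → (s m).1.2 ≠ (s n).1.2 := by
    intro m n hmn heq
    have h1 : (s n).1.2 ∈ (s (m + 1)).1.1 := hanti hmn (s n).2.1
    rw [hs] at h1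
    exact (hnext _ h1).2 heq.symm
  refine hray ⟨fun n => (s n).1.2, fun m n h => ?_, fun n => ?_⟩
  · rcases lt_trichotomy m n with hmn | hmn | hmn
    · exact (hne m n hmn h).elim
    · exact hmn
    · exact (hne n m hmn h.symm).elim
  · have := hadj (s n)
    rwa [← hs] at this

/-- Let `w` be a non-principal ultrafilter of edges, and let `c` be a vertex to which their ends
`t f` converge. Finite cuts with connected sides cannot separate `c` from all these ends. -/
theorem Rayless.not_separated (hray : D.Rayless) {ι : Type*} (u : Ultrafilter ι) {Y : ι → Set V}
    (hY : ∀ i, D.ConnectedOn (Y i)ᶜ ∧ (D.cut (Y i)).Finite) {F : Set E} (w : Ultrafilter E)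
    (hF : F ∈ w) {t : E → V} {c : V}
    (hc : ∀ Z, (D.cut Z).Finite → c ∈ Z → ∀ᶠ f in w, t f ∈ Z)
    (hcY : ∀ᶠ i in u, c ∈ Y i) (htY : ∀ f ∈ F, ∀ᶠ i in u, t f ∉ Y i) : False := by
  -- `P` consists of the vertices that no finite cut separates from `c`. The connected sides `(Y
  -- i)ᶜ` avoid `P` once `c ∈ Y i`, so all ends `t f` lie in one component of `Pᶜ`. They converge to
  -- some `c'` there, yet a finite cut separates `c'` from `c`.
  set P : Set V := {p | ∀ Z, (D.cut Z).Finite → c ∈ Z → p ∈ Z}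
  obtain ⟨f₀, hf₀⟩ := w.nonempty_of_mem hF
  have hsub : ∀ i, c ∈ Y i → (Y i)ᶜ ⊆ Pᶜ := fun i hi x hx hxP => hx (hxP _ (hY i).2 hi)
  have hmem : ∀ f ∈ F, t f ∈ D.component Pᶜ (t f₀) := by
    intro f hf
    obtain ⟨i, hi, h0, h1⟩ := (hcY.and ((htY f₀ hf₀).and (htY f hf))).exists
    exact ⟨hsub i hi h1, ((hY i).1 _ h0 _ h1).mono (hsub i hi)⟩
  obtain ⟨c', hc', hdom⟩ := hray.exists_dominating (w.map t)
    (connectedOn_component _ _)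
    (Ultrafilter.mem_map.2 (Filter.mem_of_superset hF hmem))
  refine hc'.1 fun Z hZ hcZ => ?_
  by_contra hn
  have h1 : ∀ᶠ f in w, t f ∈ Zᶜ := hdom Zᶜ (by rwa [cut_compl]) hn
  obtain ⟨f, hf, hf'⟩ := ((hc Z hZ hcZ).and h1).exists
  exact hf' hf

theorem Rayless.finite_dibonds (hray : D.Rayless) (hD : D.WeaklyConnected) (e : E) :
    {B : Set E | D.IsDibond B ∧ B.Finite ∧ e ∈ B}.Finite := by
  by_contra hinf
  obtain ⟨ι, u, X, hX, hL, hinf⟩ := exists_limit_shore hinf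
  set L := {x | ∀ᶠ i in u, x ∈ X i}
  have hL' : (D.cut L).Infinite :=
    hinf _ subset_rfl hL.isDicut (hD.cut_nonempty hL.nonempty hL.compl_nonempty)
  have : Infinite (D.cut L) := hL'.to_subtype
  set w : Ultrafilter E := (Filter.hyperfilter (D.cut L)).map Subtype.val
  have hLw : D.cut L ∈ w := Ultrafilter.mem_map.2 (Filter.univ_mem' fun f => f.2)
  have hfree : ∀ S : Set E, S.Finite → ∀ᶠ f in w, f ∉ S := fun S hS =>
    Filter.hyperfilter_le_cofinite
      (Filter.mem_cofinite.2 ((hS.preimage Subtype.val_injective.injOn).subset fun f hf => not_not.1 hf))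
  obtain ⟨c, -, hc⟩ := hray.exists_dominating (w.map D.head) hD.connectedOn_univ Filter.univ_mem
  have hhead : ∀ Z, (D.cut Z).Finite → c ∈ Z → ∀ᶠ f in w, D.head f ∈ Z := hc
  -- A finite cut contains almost none of the edges, so tails and heads have the same limits.
  have htail : ∀ Z, (D.cut Z).Finite → c ∈ Z → ∀ᶠ f in w, D.tail f ∈ Z := by
    intro Z hZ hcZ
    filter_upwards [hhead Z hZ hcZ, hfree _ hZ] with f h1 h2
    rw [mem_cut_iff] at h2
    tauto
  -- Whichever side of `L` contains `c`, the ends on the other side are separated from it by almost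
  -- all `X i`.
  by_cases hcL : c ∈ L
  · refine hray.not_separated u (Y := X) (fun i => ⟨?_, (hX i).2.2⟩) w hLw htail hcL ?_
    · exact IsDibond.connectedOn hD (by rw [cut_compl]; exact (hX i).2.1) (hX i).1.isDirected.compl
    · exact fun f hf => Ultrafilter.eventually_not.2 (hL.mem_cut.1 hf).2
  · refine hray.not_separated u (Y := fun i => (X i)ᶜ)
      (fun i => ⟨?_, by rw [cut_compl]; exact (hX i).2.2⟩) w hLw hhead
      (Ultrafilter.eventually_not.2 hcL) ?_
    · rw [compl_compl]
      exact IsDibond.connectedOn hD (hX i).2.1 (hX i).1.isDirected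
    · exact fun f hf => Filter.Eventually.mono (hL.mem_cut.1 hf).1 fun i hi => not_not.2 hi

/-! ### Nested optimal pairs for finite sets of edges -/

theorem nested_of_not_crossing {X Y : Set V} (h : ¬ Crossing X Y) :
    D.Nested (D.cut X) (D.cut Y) := by
  refine ⟨X, Y, rfl, rfl, ?_⟩
  by_contra! hc
  obtain ⟨h1, h2, h3, h4⟩ := hc
  obtain ⟨a, ha, ha'⟩ := Set.not_subset.1 h1
  obtain ⟨b, hb, hb'⟩ := Set.not_subset.1 h2
  obtain ⟨c, hc, hc'⟩ := Set.not_subset.1 h3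
  obtain ⟨d, hd, hd'⟩ := Set.not_subset.1 h4
  exact h ⟨⟨a, ha, ha'⟩, ⟨b, hb, hb'⟩, ⟨c, hc, not_not.1 hc'⟩, ⟨d, fun h => h.elim hd' hd⟩⟩

/-- Among packings of the given size, take one with least total cover. Uncrossing preserves the
cover, and a cut that is not a dibond could be replaced by a smaller dicut, lowering the total. -/
theorem exists_crossFree_dibond_packing (hD : D.WeaklyConnected) {S : Finset E}
    {M₀ : Multiset (Set V)} (hM₀ : D.IsPacking (weight S) M₀) :
    ∃ M : Multiset (Set V), M.card = M₀.card ∧ D.IsPacking (weight S) M ∧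
      (∀ X ∈ M, D.IsDibond (D.cut X)) ∧ ∀ X ∈ M, ∀ Y ∈ M, ¬ Crossing X Y := by
  classical
  have hw : ∀ e ∉ (S : Set E), weight S e = 0 := fun e he => by simpa [weight] using he
  let K : Set ℕ := {n | ∃ M, D.IsPacking (weight S) M ∧ M.card = M₀.card ∧
    ∑ e ∈ S, D.cover M e = n}
  obtain ⟨M₁, hM₁, hcard₁, hsum⟩ := Nat.sInf_mem (s := K) ⟨_, M₀, hM₀, rfl, rfl⟩
  have hmin : ∀ M, D.IsPacking (weight S) M → M.card = M₀.card →
      ∑ e ∈ S, D.cover M₁ e ≤ ∑ e ∈ S, D.cover M e := fun M hM hcard =>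
    hsum.le.trans (Nat.sInf_le ⟨M, hM, hcard, rfl⟩)
  obtain ⟨M, hcard, hsh, hcov, hcf⟩ := exists_crossFree hD S.finite_toSet M₁ hM₁.isShore
    fun X hX => hM₁.cut_subset hw hX
  have hM : D.IsPacking (weight S) M := ⟨hsh, fun e => (hcov e).trans_le (hM₁.cover_le e)⟩
  refine ⟨M, hcard.trans hcard₁, hM, fun X hX => ?_, hcf⟩
  have hX' := hsh X hX
  refine ⟨⟨hX'.isDicut, hD.cut_nonempty hX'.nonempty hX'.compl_nonempty⟩, ?_⟩
  rintro B ⟨hB, hBne⟩ hBX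
  obtain ⟨Y, hY, rfl⟩ := hB.exists_isShore hBne
  by_contra hnot
  obtain ⟨e, heX, heY⟩ := Set.not_subset.1 hnot
  obtain ⟨M', rfl⟩ := Multiset.exists_cons_of_mem hX
  have hle : ∀ f, D.cover (Y ::ₘ M') f ≤ D.cover (X ::ₘ M') f := by
    intro f
    simp only [cover_cons]
    have := @hBX f
    split_ifs <;> simp_all
  have h1 := hmin (Y ::ₘ M') ⟨fun Z hZ => (Multiset.mem_cons.1 hZ).elim (fun h => h ▸ hY)
    fun h => hsh Z (by simp [h]), fun f => (hle f).trans (hM.cover_le f)⟩ (by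
      simpa using hcard.trans hcard₁)
  have h2 : ∑ f ∈ S, D.cover (Y ::ₘ M') f < ∑ f ∈ S, D.cover (X ::ₘ M') f := by
    refine Finset.sum_lt_sum (fun f _ => hle f) ⟨e, hM.cut_subset hw hX heX, ?_⟩
    simp [cover_cons, heX, heY]
  rw [Finset.sum_congr rfl fun f _ => hcov f] at h2
  exact h2.not_ge h1

/-- `(F, 𝓑)` is a nested optimal pair for the dicuts contained in `S`. -/
structure IsNestedOptimalPairOn (D : MultiDigraph V E) (S : Finset E) (F : Finset E)
    (𝓑 : Set (Set E)) : Prop where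
  meets : ∀ B : Set E, D.IsDicut B → B ⊆ S → B.Nonempty → ((F : Set E) ∩ B).Nonempty
  dibond : ∀ B ∈ 𝓑, D.IsDibond B
  subset_edges : ∀ B ∈ 𝓑, B ⊆ S
  disjoint : 𝓑.Pairwise Disjoint
  nested : 𝓑.Pairwise D.Nested
  encard_eq : 𝓑.encard = F.card

theorem exists_transversal [Nonempty E] {F : Set E} {𝓑 : Set (Set E)}
    (hdis : 𝓑.Pairwise Disjoint) (hmeet : ∀ B ∈ 𝓑, (F ∩ B).Nonempty) :
    ∃ t : Set E → E, Set.InjOn t 𝓑 ∧ ∀ B ∈ 𝓑, t B ∈ F ∩ B := by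
  choose! t ht using hmeet
  refine ⟨t, fun B hB C hC hBC => ?_, ht⟩
  by_contra hne
  exact Set.disjoint_left.1 (hdis hB hC hne) (ht B hB).2 (hBC ▸ (ht C hC).2)

/-- A finite set that is at most as large as a disjoint family, and meets all its members, meets
each of them in exactly one element and is contained in their union. -/
theorem tight_of_encard_le {F : Set E} (hF : F.Finite) {𝓑 : Set (Set E)}
    (hdis : 𝓑.Pairwise Disjoint) (hmeet : ∀ B ∈ 𝓑, (F ∩ B).Nonempty)
    (hle : F.encard ≤ 𝓑.encard) :
    F ⊆ ⋃₀ 𝓑 ∧ ∀ B ∈ 𝓑, (F ∩ B).encard = 1 := by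
  rcases isEmpty_or_nonempty E with hE | hE
  · exact ⟨fun e => isEmptyElim e, fun B hB => isEmptyElim (hmeet B hB).some⟩
  obtain ⟨t, hinj, ht⟩ := exists_transversal hdis hmeet
  have himg : t '' 𝓑 = F := by
    refine hF.eq_of_subset_of_encard_le' ?_ (by rwa [hinj.encard_image])
    rintro _ ⟨B, hB, rfl⟩
    exact (ht B hB).1
  constructor
  · intro e he
    obtain ⟨B, hB, rfl⟩ := himg.symm ▸ he
    exact ⟨B, hB, (ht B hB).2⟩
  · intro B hB
    rw [Set.encard_eq_one]
    refine ⟨t B, Set.Subset.antisymm ?_ (Set.singleton_subset_iff.2 (ht B hB))⟩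
    rintro e ⟨heF, heB⟩
    obtain ⟨C, hC, rfl⟩ := himg.symm ▸ heF
    by_contra hne
    have hBC : C ≠ B := fun h => hne (by simp [h])
    exact Set.disjoint_left.1 (hdis hC hB hBC) (ht C hC).2 heB

theorem exists_isNestedOptimalPairOn (hD : D.WeaklyConnected) (S : Finset E) :
    ∃ F 𝓑, D.IsNestedOptimalPairOn S F 𝓑 := by
  classical
  obtain ⟨F, M₀, -, hM₀, hcard₀, hF⟩ := lucchesi_younger hD S
  obtain ⟨M, hcard, hM, hbond, hcf⟩ := exists_crossFree_dibond_packing hD hM₀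
  have hdis : ∀ X Y M', M = X ::ₘ Y ::ₘ M' → Disjoint (D.cut X) (D.cut Y) := by
    rintro X Y M' rfl
    refine Set.disjoint_left.2 fun e hX hY => ?_
    have := hM.cover_le e
    simp only [cover_cons, hX, hY, if_true, weight] at this
    split_ifs at this <;> omega
  have hcons : ∀ X ∈ M, ∀ Y ∈ M, X ≠ Y → Disjoint (D.cut X) (D.cut Y) := by
    intro X hX Y hY hne
    obtain ⟨M', rfl⟩ := Multiset.exists_cons_of_mem hX
    obtain ⟨M'', rfl⟩ :=
      Multiset.exists_cons_of_mem ((Multiset.mem_cons.1 hY).resolve_left hne.symm)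
    exact hdis X Y M'' rfl
  have hne : ∀ X ∈ M, (D.cut X).Nonempty := fun X hX => (hbond X hX).1.2
  have hnodup : M.Nodup := by
    rw [Multiset.nodup_iff_le]
    intro X hX
    obtain ⟨M', rfl⟩ := Multiset.le_iff_exists_add.1 hX
    have := hdis X X M' (by simp)
    rw [disjoint_self] at this
    exact (hne X (by simp)).ne_empty this
  have hinj : Set.InjOn D.cut {X | X ∈ M} := by
    intro X hX Y hY hXY
    by_contra h
    have := hcons X hX Y hY h
    rw [hXY, disjoint_self] at this
    exact (hne Y hY).ne_empty this
  refine ⟨F, D.cut '' {X | X ∈ M}, ?_, ?_, ?_, ?_, ?_, ?_⟩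
  · intro B hB hBS hBne
    obtain ⟨X, hX, rfl⟩ := hB.exists_isShore hBne
    exact hF X hX hBS
  · rintro _ ⟨X, hX, rfl⟩
    exact hbond X hX
  · rintro _ ⟨X, hX, rfl⟩
    exact hM.cut_subset (fun e he => by simpa [weight] using he) hX
  · rintro _ ⟨X, hX, rfl⟩ _ ⟨Y, hY, rfl⟩ h
    exact hcons X hX Y hY fun hXY => h (hXY ▸ rfl)
  · rintro _ ⟨X, hX, rfl⟩ _ ⟨Y, hY, rfl⟩ -
    exact nested_of_not_crossing (hcf X hX Y hY)
  · rw [hinj.encard_image, ← hcard₀, ← hcard, ← Multiset.toFinset_card_of_nodup hnodup,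
      ← Set.encard_coe_eq_coe_finsetCard]
    congr 1
    ext X
    simp

theorem IsNestedOptimalPairOn.tight {S F : Finset E} {𝓑 : Set (Set E)}
    (h : D.IsNestedOptimalPairOn S F 𝓑) :
    (F : Set E) ⊆ ⋃₀ 𝓑 ∧ ∀ B ∈ 𝓑, ((F : Set E) ∩ B).encard = 1 :=
  tight_of_encard_le F.finite_toSet h.disjoint
    (fun B hB => h.meets B (h.dibond B hB).1.1 (h.subset_edges B hB) (h.dibond B hB).1.2)
    (by simp [h.encard_eq])

/-! ### Compactness -/

theorem exists_ultrafilter_finset (α : Type*) :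
    ∃ u : Ultrafilter (Finset α), ∀ B : Set α, B.Finite → ∀ᶠ S : Finset α in u, B ⊆ S := by
  refine ⟨Ultrafilter.of Filter.atTop, fun B hB => ?_⟩
  refine Ultrafilter.of_le _ (Filter.mem_atTop_sets.2 ⟨hB.toFinset, fun S hS => ?_⟩)
  exact fun e he => hS (by simpa using he)

theorem isFinitaryDijoin_limit {u : Ultrafilter (Finset E)}
    (hu : ∀ B : Set E, B.Finite → ∀ᶠ S : Finset E in u, B ⊆ S) {F : Finset E → Finset E}
    (hF : ∀ S : Finset E, ∀ B : Set E, D.IsDicut B → B ⊆ S → B.Nonempty →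
      ((F S : Set E) ∩ B).Nonempty) :
    D.IsFinitaryDijoin {e | ∀ᶠ S in u, e ∈ F S} := by
  intro B hB hfin hne
  have h : ⋃ e ∈ B, {S | e ∈ F S} ∈ u := by
    filter_upwards [hu B hfin] with S hS
    obtain ⟨e, he, heB⟩ := hF S B hB hS hne
    exact Set.mem_biUnion heB he
  obtain ⟨e, he, heF⟩ := (Ultrafilter.finite_biUnion_mem_iff hfin).1 h
  exact ⟨e, heF, he⟩

theorem encard_limit_inter_eq_one {u : Ultrafilter (Finset E)} {F : Finset E → Finset E}
    {B : Set E} (hne : ({e | ∀ᶠ S in u, e ∈ F S} ∩ B).Nonempty)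
    (hB : ∀ᶠ S in u, ((F S : Set E) ∩ B).encard ≤ 1) :
    ({e | ∀ᶠ S in u, e ∈ F S} ∩ B).encard = 1 := by
  refine le_antisymm (Set.encard_le_one_iff.2 ?_) (Set.one_le_encard_iff_nonempty.2 hne)
  rintro e f ⟨he : ∀ᶠ S in u, e ∈ F S, heB⟩ ⟨hf : ∀ᶠ S in u, f ∈ F S, hfB⟩
  obtain ⟨S, hS, heS, hfS⟩ := (hB.and (he.and hf)).exists
  exact Set.encard_le_one_iff.1 hS e f ⟨heS, heB⟩ ⟨hfS, hfB⟩

theorem exists_isNestedOptimalPair_of_finite_dibonds (hD : D.WeaklyConnected)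
    (hfin : ∀ e : E, {B : Set E | D.IsDibond B ∧ B.Finite ∧ e ∈ B}.Finite) :
    ∃ (F : Set E) (𝓑 : Set (Set E)), D.IsNestedOptimalPair F 𝓑 := by
  obtain ⟨u, hu⟩ := exists_ultrafilter_finset E
  choose F 𝓑 h using exists_isNestedOptimalPairOn hD
  refine ⟨{e | ∀ᶠ S in u, e ∈ F S}, {B | ∀ᶠ S in u, B ∈ 𝓑 S},
    isFinitaryDijoin_limit hu fun S => (h S).meets, ?_, ?_, ?_, ?_, ?_, ?_⟩
  · intro B (hB : ∀ᶠ S in u, B ∈ 𝓑 S)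
    obtain ⟨S, hS⟩ := hB.exists
    exact (h S).dibond B hS
  · intro B (hB : ∀ᶠ S in u, B ∈ 𝓑 S)
    obtain ⟨S, hS⟩ := hB.exists
    exact S.finite_toSet.subset ((h S).subset_edges B hS)
  · intro B (hB : ∀ᶠ S in u, B ∈ 𝓑 S) C (hC : ∀ᶠ S in u, C ∈ 𝓑 S) hne
    obtain ⟨S, hS, hS'⟩ := (hB.and hC).exists
    exact (h S).disjoint hS hS' hne
  · intro B (hB : ∀ᶠ S in u, B ∈ 𝓑 S) C (hC : ∀ᶠ S in u, C ∈ 𝓑 S) hne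
    obtain ⟨S, hS, hS'⟩ := (hB.and hC).exists
    exact (h S).nested hS hS' hne
  · intro e he
    -- Only finitely many dibonds can cover `e`, so one of them does so for almost all `S`.
    have hmem : ⋃ B ∈ {B : Set E | D.IsDibond B ∧ B.Finite ∧ e ∈ B}, {S | B ∈ 𝓑 S} ∈ u := by
      filter_upwards [he] with S hS
      obtain ⟨B, hB, heB⟩ := (h S).tight.1 hS
      exact Set.mem_biUnion
        ⟨(h S).dibond B hB, S.finite_toSet.subset ((h S).subset_edges B hB), heB⟩ hB
    obtain ⟨B, hB, hB'⟩ := (Ultrafilter.finite_biUnion_mem_iff (hfin e)).1 hmem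
    exact ⟨B, hB', hB.2.2⟩
  · intro B (hB : ∀ᶠ S in u, B ∈ 𝓑 S)
    obtain ⟨S₀, hS₀⟩ := hB.exists
    have hbond := (h S₀).dibond B hS₀
    have hBfin : B.Finite := S₀.finite_toSet.subset ((h S₀).subset_edges B hS₀)
    obtain ⟨e, he, heB⟩ := isFinitaryDijoin_limit hu (fun S => (h S).meets) B hbond.1.1 hBfin
      hbond.1.2
    refine encard_limit_inter_eq_one ⟨e, he, heB⟩ ?_
    filter_upwards [hB] with S hS using ((h S).tight.2 B hS).le

theorem exists_isNestedOptimalPair_of_bounded (hD : D.WeaklyConnected) {n : ℕ}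
    (hn : ∀ 𝓒 : Set (Set E), D.IsDisjointDicutFamily 𝓒 → 𝓒.Pairwise D.Nested → 𝓒.encard ≤ n) :
    ∃ (F : Set E) (𝓑 : Set (Set E)), D.IsNestedOptimalPair F 𝓑 := by
  obtain ⟨u, hu⟩ := exists_ultrafilter_finset E
  choose F 𝓑 h using exists_isNestedOptimalPairOn hD
  have hfinite : ∀ S, ∀ B ∈ 𝓑 S, B.Finite := fun S B hB =>
    S.finite_toSet.subset ((h S).subset_edges B hB)
  have hb : BddAbove (Set.range fun S => (F S).card) := by
    refine ⟨n, ?_⟩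
    rintro _ ⟨S, rfl⟩
    have := hn (𝓑 S) ⟨fun B hB => ((h S).dibond B hB).1.1, hfinite S,
      fun B hB => ((h S).dibond B hB).1.2, (h S).disjoint⟩ (h S).nested
    rw [(h S).encard_eq] at this
    exact_mod_cast this
  obtain ⟨S₀, hS₀⟩ := Nat.sSup_mem (Set.range_nonempty fun S => (F S).card) hb
  have hmax : ∀ S, (F S).card ≤ (F S₀).card := fun S => (le_csSup hb ⟨S, rfl⟩).trans hS₀.ge
  -- `F S` must meet all members of `𝓑 S₀` and, by the choice of `S₀`, has no edge to spare.
  have htight : ∀ S, S₀ ⊆ S → (F S : Set E) ⊆ ⋃₀ 𝓑 S₀ ∧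
      ∀ B ∈ 𝓑 S₀, ((F S : Set E) ∩ B).encard = 1 := by
    intro S hS
    refine tight_of_encard_le (F S).finite_toSet (h S₀).disjoint (fun B hB => ?_) ?_
    · exact (h S).meets B ((h S₀).dibond B hB).1.1
        (((h S₀).subset_edges B hB).trans (Finset.coe_subset.2 hS)) ((h S₀).dibond B hB).1.2
    · rw [(h S₀).encard_eq, Set.encard_coe_eq_coe_finsetCard]
      exact_mod_cast hmax S
  have hlarge : ∀ᶠ S : Finset E in u, S₀ ⊆ S := by
    filter_upwards [hu S₀ S₀.finite_toSet] with S hS using Finset.coe_subset.1 hS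
  have hdijoin := isFinitaryDijoin_limit hu fun S => (h S).meets
  refine ⟨{e | ∀ᶠ S in u, e ∈ F S}, 𝓑 S₀, hdijoin, (h S₀).dibond, hfinite S₀, (h S₀).disjoint,
    (h S₀).nested, ?_, ?_⟩
  · intro e (he : ∀ᶠ S in u, e ∈ F S)
    obtain ⟨S, hS, hS'⟩ := (he.and hlarge).exists
    exact (htight S hS').1 hS
  · intro B hB
    obtain ⟨e, he, heB⟩ := hdijoin B ((h S₀).dibond B hB).1.1 (hfinite S₀ B hB)
      ((h S₀).dibond B hB).1.2
    refine encard_limit_inter_eq_one ⟨e, he, heB⟩ ?_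
    filter_upwards [hlarge] with S hS using ((htight S hS).2 B hB).le

theorem IsFinitaryDijoin.encard_le {F : Set E} (hF : D.IsFinitaryDijoin F) {𝓒 : Set (Set E)}
    (h𝓒 : D.IsDisjointDicutFamily 𝓒) : 𝓒.encard ≤ F.encard := by
  have hmeet : ∀ B ∈ 𝓒, (F ∩ B).Nonempty := fun B hB =>
    hF B (h𝓒.dicut B hB) (h𝓒.finite B hB) (h𝓒.nonempty B hB)
  rcases 𝓒.eq_empty_or_nonempty with rfl | ⟨B₀, hB₀⟩
  · simp
  have : Nonempty E := ⟨(hmeet B₀ hB₀).some⟩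
  obtain ⟨t, hinj, ht⟩ := exists_transversal h𝓒.disjoint hmeet
  exact Set.encard_le_encard_of_injOn (fun B hB => (ht B hB).1) hinj

end MultiDigraph

theorem theorem1p7 {V : Type u} {E : Type v} (D : MultiDigraph V E)
    (hloop : D.Loopless) (hconn : D.WeaklyConnected)
    (h :
      -- there is a finitary dijoin of finite size
      (∃ F : Set E, D.IsFinitaryDijoin F ∧ F.Finite) ∨
      -- the maximal number of disjoint finite dicuts is finite
      (∃ n : ℕ, ∀ 𝓒 : Set (Set E), D.IsDisjointDicutFamily 𝓒 → 𝓒.encard ≤ n) ∨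
      -- the maximal number of disjoint and pairwise nested finite dicuts is finite
      (∃ n : ℕ, ∀ 𝓒 : Set (Set E), D.IsDisjointDicutFamily 𝓒 → 𝓒.Pairwise D.Nested →
        𝓒.encard ≤ n) ∨
      -- every edge lies in only finitely many finite dibonds
      (∀ e : E, {B : Set E | D.IsDibond B ∧ B.Finite ∧ e ∈ B}.Finite) ∨
      -- there is no infinite dibond
      (∀ B : Set E, D.IsDibond B → B.Finite) ∨
      -- rayless
      D.Rayless) :
    ∃ (F : Set E) (𝓑 : Set (Set E)), D.IsNestedOptimalPair F 𝓑 := by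
  rcases h with ⟨F, hF, hfin⟩ | ⟨n, hn⟩ | ⟨n, hn⟩ | h | h | h
  · refine MultiDigraph.exists_isNestedOptimalPair_of_bounded hconn (n := F.ncard) ?_
    intro 𝓒 h𝓒 _
    rw [hfin.cast_ncard_eq]
    exact hF.encard_le h𝓒
  · exact MultiDigraph.exists_isNestedOptimalPair_of_bounded hconn fun 𝓒 h𝓒 _ => hn 𝓒 h𝓒
  · exact MultiDigraph.exists_isNestedOptimalPair_of_bounded hconn hn
  · exact MultiDigraph.exists_isNestedOptimalPair_of_finite_dibonds hconn h
  · exact MultiDigraph.exists_isNestedOptimalPair_of_finite_dibonds hconn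
      (MultiDigraph.finite_dibonds_of_forall_dibond_finite hconn h)
  · exact MultiDigraph.exists_isNestedOptimalPair_of_finite_dibonds hconn
      (h.finite_dibonds hconn)
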